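/- **Theorem (traversal preserved by the container isomorphism).** An applicative functor is a lax monoidal functor $F:\mathbf{Set}\to\mathbf{Set}$ with respect to $(\times,1)$, with unit $u\in F1$ and action $\star: FX\times FY\to F(X\times Y)$ (equivalently, a lawful $\mathrm{pure}$/$\circledast$ structure). A functor $T:\mathbf{Set}\to\mathbf{Set}$ is traversable if it is equipped with a family $\mathrm{traverse}_{F,A,B}:(A\to FB)\to TA\to F(TB)$, natural in $A$, $B$ and (for applicative morphisms) in the applicative functor $F$, such that $\mathrm{traverse}_{FG}(Fg\circ f)=F(\mathrm{traverse}_G\,g)\circ\mathrm{traverse}_F\,f$ (linearity) and $\mathrm{traverse}_{\mathrm{Id}}(\mathrm{id}_A)=\mathrm{id}_{TA}$ (unity). For sets $A,B$ let $R^*_{A,B}X=\sum_{n\in\mathbb N}A^n\times(B^n\to X)$, the applicative functor with $R^*_{A,B}(h)(n,as,g)=(n,as,h\circ g)$, $u=(0,*,\lambda bs.\,*)$ and $(n,as,f)\star(m,as',g)=(n+m,\,as\mathbin{+\!\!+}as',\,\lambda bs.\,(f(\mathrm{take}\,n\,bs),g(\mathrm{drop}\,n\,bs)))$. Put $\dim(n,as,g)=n$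 and $\mathrm{wrap}_{A,B}\,a=(1,a,\mathrm{id}_B)\in R^*_{A,B}B$, so that $\mathrm{traverse}\,\mathrm{wrap}_{A,B}:TA\to R^*_{A,B}(TB)$. A finitary container is a set $S$ with a function $ar:S\to\mathbb N$; its extension is the functor $[\![S,ar]\!]X=\sum_{s\in S}X^{ar(s)}$, and its canonical traversal is $\mathrm{traverse}\,f\,(s,xs)=F(\lambda c.\,(s,c))(\mathrm{collect}_{ar(s)}\,f\,xs)$, where $\mathrm{collect}_n\,f\,(x_1,\dots,x_n)=f(x_1)\star\cdots\star f(x_n)\in F(B^n)$ (for $n=0$ it is $u$). Let $T$ be a traversable functor. For every set $X$ define $$\Phi_X: TX\to[\![T1,\ \lambda s.\dim(\mathrm{traverse}\,\mathrm{wrap}_{1,1}\,s)]\!]X,\qquad \Phi_X(x)=(g(*^n),\,i)\ \text{ where }(n,i,g)=\mathrm{traverse}\,\mathrm{wrap}_{X,1}\,x$$ and $*^n$ is the unique element of $1^n$. (The arity of the shape $g(*^n)$ is $n$, so this is well defined.) Then every $\Phi_X$ is a bijection, and for every applicative functor $F$, all sets $A,B$, every $f:A\to FB$ and every $x\in TA$,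 $$F(\Phi_B)\,(\mathrm{traverse}\,f\,x)=\mathrm{traverse}\,f\,(\Phi_A\,x),$$ where $\mathrm{traverse}$ on the left is the given traversal of $T$ and on the right is the canonical traversal of the container. That is, the isomorphism $\Phi$ carries the given traversal of $T$ to the canonical one. -/

import Mathlib

universe u

namespace TraversableContainer

section Monoidal

variable {F : Type u → Type u} [Applicative F]

/-- The monoidal action `F X × F Y → F (X × Y)` of an applicative functor. (The monoidal unit
is `pure PUnit.unit`.) -/
def starProd {X Y : Type u} (x : F X) (y : F Y) : F (X × Y) :=
  Prod.mk <$> x <*> y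

/-- `collect n f (x₁, …, xₙ) = f x₁ ⋆ ⋯ ⋆ f xₙ`, where the iterated product is read as a vector
of length `n`; for `n = 0` it is the monoidal unit, read as the empty vector. -/
def collect {A B : Type u} (f : A → F B) : (n : ℕ) → (Fin n → A) → F (Fin n → B)
  | 0, _ => pure Fin.elim0
  | n + 1, xs =>
    (fun p : B × (Fin n → B) => (Fin.cons p.1 p.2 : Fin (n + 1) → B)) <$>
      starProd (f (xs 0)) (collect f n (fun i => xs i.succ))

end Monoidal

/-- The functor `R*_{A,B}`, `R*_{A,B} X = Σ n : ℕ, Aⁿ × (Bⁿ → X)`, the free applicative functor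
on the functor `X ↦ A × (B → X)`. -/
@[ext]
structure FreeApp (A B X : Type u) : Type u where
  /-- the dimension -/
  dim : ℕ
  /-- the position -/
  pos : Fin dim → A
  /-- peeking into a new position -/
  peek : (Fin dim → B) → X

namespace FreeApp

variable {A B C X Y : Type u}

/-- The action on morphisms, `(n, as, g) ↦ (n, as, h ∘ g)`. -/
def map (h : X → Y) (r : FreeApp A B X) : FreeApp A B Y :=
  ⟨r.dim, r.pos, h ∘ r.peek⟩

/-- `(n, as, f) ⋆ (m, as', g) = (n + m, as ++ as', bs ↦ (f (take n bs), g (drop n bs)))`. -/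
def mul (r : FreeApp A B X) (s : FreeApp A B Y) : FreeApp A B (X × Y) :=
  ⟨r.dim + s.dim, Fin.append r.pos s.pos,
    fun bs => (r.peek fun i => bs (Fin.castAdd s.dim i), s.peek fun i => bs (Fin.natAdd r.dim i))⟩

/-- The applicative structure obtained from the monoidal one: `pure x` is the image of the
monoidal unit `(0, *, bs ↦ *)` under the constant map `x`, and `r <*> s` is the image of `r ⋆ s`
under evaluation. -/
instance : Applicative (FreeApp A B) where
  map := map
  pure x := ⟨0, Fin.elim0, fun _ => x⟩
  seq r s := map (fun p => p.1 p.2) (mul r (s ()))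

theorem map_def (h : X → Y) (r : FreeApp A B X) : h <$> r = ⟨r.dim, r.pos, h ∘ r.peek⟩ := rfl

theorem pure_def (x : X) : (pure x : FreeApp A B X) = ⟨0, Fin.elim0, fun _ => x⟩ := rfl

theorem seq_def (r : FreeApp A B (X → Y)) (s : FreeApp A B X) :
    r <*> s = ⟨r.dim + s.dim, Fin.append r.pos s.pos,
      fun bs => r.peek (fun i => bs (Fin.castAdd s.dim i))
        (s.peek fun i => bs (Fin.natAdd r.dim i))⟩ := rfl

theorem ext_cast {r s : FreeApp A B X} (h : r.dim = s.dim)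
    (hp : ∀ i, r.pos i = s.pos (Fin.cast h i))
    (hk : ∀ bs, r.peek (fun i => bs (Fin.cast h i)) = s.peek bs) : r = s := by
  obtain ⟨n, p, k⟩ := r
  obtain ⟨m, q, l⟩ := s
  obtain rfl : n = m := h
  have h1 : p = q := funext hp
  have h2 : k = l := funext hk
  rw [h1, h2]

instance : LawfulApplicative (FreeApp A B) where
  map_const := rfl
  id_map _ := rfl
  comp_map _ _ _ := rfl
  seqLeft_eq _ _ := rfl
  seqRight_eq _ _ := rfl
  pure_seq g x := by
    refine ext_cast (Nat.zero_add _) (fun i => ?_) (fun bs => ?_)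
    · simp only [pure_def, seq_def, map_def]
      rw [Fin.append_left_nil _ _ rfl]
      rfl
    · simp only [pure_def, seq_def, map_def]
      congr 2
      funext i
      congr 1
      ext
      simp
  map_pure _ _ := rfl
  seq_pure g x := by
    refine ext_cast (Nat.add_zero _) (fun i => ?_) (fun bs => ?_)
    · simp only [pure_def, seq_def, map_def]
      rw [Fin.append_right_nil _ _ rfl]
      rfl
    · rfl
  seq_assoc x g h := by
    refine ext_cast (Nat.add_assoc _ _ _).symm (fun i => ?_) (fun bs => ?_)
    · simp only [seq_def, map_def]
      rw [Fin.append_assoc]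
      rfl
    · simp only [seq_def, map_def, Function.comp_apply]
      have h1 : ∀ i : Fin h.dim, Fin.cast (Nat.add_assoc h.dim g.dim x.dim).symm
          (Fin.castAdd (g.dim + x.dim) i) = Fin.castAdd x.dim (Fin.castAdd g.dim i) :=
        fun i => Fin.ext rfl
      have h2 : ∀ i : Fin g.dim, Fin.cast (Nat.add_assoc h.dim g.dim x.dim).symm
          (Fin.natAdd h.dim (Fin.castAdd x.dim i)) = Fin.castAdd x.dim (Fin.natAdd h.dim i) :=
        fun i => Fin.ext rfl
      have h3 : ∀ i : Fin x.dim, Fin.cast (Nat.add_assoc h.dim g.dim x.dim).symm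
          (Fin.natAdd h.dim (Fin.natAdd g.dim i)) = Fin.natAdd (h.dim + g.dim) i :=
        fun i => Fin.ext (Nat.add_assoc _ _ _).symm
      exact congr (congrArg h.peek (funext fun i => congrArg bs (h1 i)))
        (congr (congrArg g.peek (funext fun i => congrArg bs (h2 i)))
          (congrArg x.peek (funext fun i => congrArg bs (h3 i))))

/-- `wrap a = (1, a, id)`, with `X¹` read as functions on `Fin 1`. -/
def wrap (A B : Type u) (a : A) : FreeApp A B B :=
  ⟨1, fun _ => a, fun bs => bs 0⟩

/-- The comultiplication `(n, as, g) ↦ (n, as, bs ↦ (n, bs, g))`, an applicative morphism. -/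
def comult (A B C : Type u) :
    ApplicativeTransformation (FreeApp A C) (Functor.Comp (FreeApp A B) (FreeApp B C)) where
  app _ r := Functor.Comp.mk ⟨r.dim, r.pos, fun bs => ⟨r.dim, bs, r.peek⟩⟩
  preserves_pure' x := by
    refine congrArg Functor.Comp.mk (ext_cast rfl (fun _ => rfl) fun bs => ?_)
    exact ext_cast rfl (fun i => i.elim0) fun _ => rfl
  preserves_seq' r s := by
    refine congrArg Functor.Comp.mk (ext_cast rfl (fun _ => rfl) fun bs => ?_)
    refine ext_cast rfl (fun i => ?_) fun _ => rfl
    exact (congrFun (Fin.append_castAdd_natAdd (f := bs)) i).symm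

end FreeApp

/-- A finitary container: a set of shapes and an arity function. -/
structure FinContainer : Type (u + 1) where
  Shape : Type u
  arity : Shape → ℕ

/-- The extension `X ↦ Σ s : S, X ^ (ar s)` of a finitary container `(S, ar)`. -/
def FinContainer.Ext (C : FinContainer.{u}) (X : Type u) : Type u :=
  Σ s : C.Shape, (Fin (C.arity s) → X)

/-- The extension of a finitary container, with its action on morphisms and its canonical
traversal. -/
instance (C : FinContainer.{u}) : Traversable C.Ext where
  map h c := ⟨c.1, h ∘ c.2⟩
  traverse f c := (fun ys => (⟨c.1, ys⟩ : C.Ext _)) <$> collect f (C.arity c.1) c.2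

section Traversal

variable (T : Type u → Type u) [Traversable T]

/-- The coalgebra `t_{A,B} = traverse wrap_{A,B} : T A → R*_{A,B} (T B)` of a traversal. -/
def coalg {A : Type u} (B : Type u) (x : T A) : FreeApp A B (T B) :=
  traverse (FreeApp.wrap A B) x

/-- The finitary container of shapes `T 1` and arities `s ↦ dim (traverse wrap s)`. -/
def containerOf : FinContainer.{u} where
  Shape := T PUnit
  arity s := (coalg T PUnit s).dim

variable [LawfulTraversable T]

theorem comult_coalg {A : Type u} (B C : Type u) (x : T A) :
    FreeApp.comult A B C (coalg T C x) = Functor.Comp.mk (coalg T C <$> coalg T B x) := by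
  have h := LawfulTraversable.comp_traverse (FreeApp.wrap B C) (FreeApp.wrap A B) x
  unfold coalg
  rw [LawfulTraversable.naturality]
  refine Eq.trans ?_ h
  congr 1
  funext a
  refine congrArg Functor.Comp.mk (FreeApp.ext_cast rfl (fun _ => rfl) fun bs => ?_)
  refine FreeApp.ext_cast rfl (fun i => ?_) fun _ => rfl
  exact congrArg bs (Subsingleton.elim (α := Fin 1) _ _)

theorem dim_coalg_peek {A B : Type u} (C : Type u) (x : T A)
    (bs : Fin (coalg T B x).dim → B) :
    (coalg T C ((coalg T B x).peek bs)).dim = (coalg T C x).dim := by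
  have key : ∀ r s : FreeApp A B (FreeApp B C (T C)), r = s →
      (∀ v, (r.peek v).dim = (coalg T C x).dim) →
      ∀ v, (s.peek v).dim = (coalg T C x).dim := by
    rintro r _ rfl h
    exact h
  exact key _ _ (comult_coalg T B C x) (fun _ => rfl) bs

/-- `Φ x = (g (*ⁿ), i)` for `(n, i, g) = traverse wrap x`. The arity of the shape `g (*ⁿ)` equals
`n` by a theorem only, so the vector `i` is reindexed along that equality. -/
def Phi {X : Type u} (x : T X) : (containerOf T).Ext X :=
  ⟨(coalg T PUnit x).peek fun _ => PUnit.unit,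
    fun j => (coalg T PUnit x).pos (Fin.cast (dim_coalg_peek T PUnit x _) j)⟩

end Traversal

end TraversableContainer

/-!
Since `FreeApp A B` is free on `X ↦ A × (B → X)`, any `f : A → F B` extends to an applicative
morphism out of it, and naturality of `traverse` along this morphism recovers `traverse f` from
`coalg T B`. For a shape `s : T 1` the comultiplication law shows that the dimension of
`coalg T X s` does not depend on `X`, so that its `peek` fills the positions of `s` with elements of
`X`, and that `coalg T B` sends a filled shape back to the shape and its filling. Hence filling
inverts `Phi`, and traversing a filled shape collects over its positions and refills it, which is
the canonical traversal.
-/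

namespace TraversableContainer

section Collect

variable {F : Type u → Type u} [Applicative F] [LawfulApplicative F] {A B : Type u}

theorem collect_cons (f : A → F B) {n : ℕ} (x : A) (xs : Fin n → A) :
    collect f (n + 1) (Fin.cons x xs) =
      (fun b (bs : Fin n → B) => (Fin.cons b bs : Fin (n + 1) → B)) <$> f x <*>
        collect f n xs := by
  simp only [collect, starProd, map_seq, Functor.map_map, Fin.cons_zero, Fin.cons_succ]
  rfl

theorem collect_comp_cast (f : A → F B) {n m : ℕ} (h : n = m) (xs : Fin m → A) :
    collect f n (xs ∘ Fin.cast h) = (· ∘ Fin.cast h) <$> collect f m xs := by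
  subst h
  exact (id_map _).symm

theorem collect_append (f : A → F B) {n m : ℕ} (xs : Fin n → A) (ys : Fin m → A) :
    collect f (n + m) (Fin.append xs ys) =
      Fin.append <$> collect f n xs <*> collect f m ys := by
  induction xs using Fin.consInduction with
  | elim0 =>
    rw [Fin.elim0_append, collect_comp_cast, collect, map_pure, pure_seq]
    exact congrArg (· <$> _) (funext fun bs => (Fin.elim0_append bs).symm)
  | @cons n x xs ih =>
    have append_cons (b : B) (bs : Fin n → B) : Fin.append (Fin.cons b bs : Fin (n + 1) → B) =
        fun cs : Fin m → B => (Fin.cons b (Fin.append bs cs) : Fin (n + m + 1) → B) ∘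
          Fin.cast (Nat.add_right_comm n 1 m) := funext (Fin.append_cons b bs)
    rw [Fin.append_cons, collect_comp_cast, collect_cons, collect_cons, ih]
    simp only [map_seq, seq_assoc, Functor.map_map, seq_map_assoc, Function.comp_def, append_cons]

theorem collect_one (f : A → F B) (xs : Fin 1 → A) :
    collect f 1 xs = (fun b _ => b) <$> f (xs 0) := by
  rw [← Fin.cons_self_tail xs, collect_cons, collect, seq_pure, Functor.map_map]
  refine congrArg (· <$> _) (funext fun b => funext fun i => ?_)
  rw [Fin.eq_zero i]
  rfl

theorem collect_pure {n : ℕ} (xs : Fin n → A) : collect (pure : A → F A) n xs = pure xs := by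
  induction xs using Fin.consInduction with
  | elim0 => rfl
  | cons x xs ih => rw [collect_cons, ih, map_pure, pure_seq, map_pure]

end Collect

namespace FreeApp

theorem mk_eq_mk_comp_cast {A B X : Type u} {n m : ℕ} (h : n = m) (as : Fin n → A)
    (g : (Fin n → B) → X) :
    (⟨n, as, g⟩ : FreeApp A B X) =
      ⟨m, as ∘ Fin.cast h.symm, fun bs => g (bs ∘ Fin.cast h)⟩ := by
  subst h
  rfl

variable {F : Type u → Type u} [Applicative F] [LawfulApplicative F] {A B X : Type u}

/-- The applicative morphism `FreeApp A B → F` extending `f : A → F B`, that is, the universal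
property of the free applicative functor. -/
def lift (f : A → F B) : ApplicativeTransformation (FreeApp A B) F where
  app _ r := r.peek <$> collect f r.dim r.pos
  preserves_pure' x := by
    simp only [pure_def, collect, map_pure]
  preserves_seq' r s := by
    simp only [seq_def, collect_append, map_seq, Functor.map_map, seq_map_assoc, Function.comp_def,
      Fin.append_left, Fin.append_right]

theorem lift_apply (f : A → F B) (r : FreeApp A B X) :
    lift f r = r.peek <$> collect f r.dim r.pos := rfl

theorem lift_wrap (f : A → F B) (a : A) : lift f (wrap A B a) = f a := by
  rw [lift_apply, wrap, collect_one, Functor.map_map]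
  exact id_map _

theorem lift_pure (r : FreeApp A A X) : lift (pure : A → F A) r = pure (r.peek r.pos) := by
  rw [lift_apply, collect_pure, map_pure]

end FreeApp

section Traversal

variable (T : Type u → Type u) [Traversable T] [LawfulTraversable T]

theorem traverse_eq_lift_coalg {F : Type u → Type u} [Applicative F] [LawfulApplicative F]
    {A B : Type u} (f : A → F B) (x : T A) : traverse f x = FreeApp.lift f (coalg T B x) := by
  rw [coalg, LawfulTraversable.naturality]
  exact congrArg (traverse · x) (funext fun a => (FreeApp.lift_wrap f a).symm)

theorem coalg_peek_pos {A : Type u} (x : T A) : (coalg T A x).peek (coalg T A x).pos = x :=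
  calc (coalg T A x).peek (coalg T A x).pos
      = FreeApp.lift (pure : A → Id A) (coalg T A x) := (FreeApp.lift_pure (F := Id) _).symm
    _ = traverse (pure : A → Id A) x := (traverse_eq_lift_coalg T _ x).symm
    _ = x := LawfulTraversable.id_traverse x

theorem coalg_dim_eq {A : Type u} (B C : Type u) (x : T A) :
    (coalg T B x).dim = (coalg T C x).dim :=
  (congrArg (fun r => r.run.dim) (comult_coalg T B C x)).symm

-- The witness is `bs` up to reindexing; leaving it existential avoids a transport.
theorem exists_coalg_coalg_peek_eq {A B : Type u} (C : Type u) (x : T A)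
    (bs : Fin (coalg T B x).dim → B) :
    ∃ cs, coalg T C ((coalg T B x).peek bs) = ⟨(coalg T C x).dim, cs, (coalg T C x).peek⟩ := by
  have peek_comult : ∀ v, ∃ cs, (FreeApp.comult A B C (coalg T C x)).run.peek v =
      ⟨(coalg T C x).dim, cs, (coalg T C x).peek⟩ := fun v => ⟨v, rfl⟩
  rw [comult_coalg] at peek_comult
  exact peek_comult bs

/-- The element of `T X` with shape `s` and contents `v`. The dimension of `coalg T X s` equals
the arity of `s` by a theorem only, so `v` is reindexed along that equality. -/
def fill {X : Type u} (s : T PUnit) (v : Fin ((containerOf T).arity s) → X) : T X :=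
  (coalg T X s).peek (v ∘ Fin.cast (coalg_dim_eq T X PUnit s))

theorem coalg_shape (X : Type u) (s : T PUnit) :
    coalg T X s = ⟨(containerOf T).arity s, fun _ => PUnit.unit, fill T s⟩ :=
  FreeApp.mk_eq_mk_comp_cast (coalg_dim_eq T X PUnit s) _ _

theorem coalg_fill {X : Type u} (B : Type u) (s : T PUnit)
    (v : Fin ((containerOf T).arity s) → X) :
    coalg T B (fill T s v) = ⟨(containerOf T).arity s, v, fill T s⟩ := by
  have comult_shape := comult_coalg T X B s
  rw [coalg_shape T B, coalg_shape T X] at comult_shape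
  have peeks_eq := eq_of_heq (FreeApp.mk.inj comult_shape).2.2
  exact (congrFun peeks_eq v).symm

theorem exists_fill_eq {X : Type u} (x : T X) : ∃ s v, fill T s v = x := by
  let s := (coalg T PUnit x).peek fun _ => PUnit.unit
  obtain ⟨cs, hs⟩ := exists_coalg_coalg_peek_eq T X x fun _ => PUnit.unit
  have shape_eq := (coalg_shape T X s).symm.trans hs
  have mem_range : x ∈ Set.range (FreeApp.mk _ cs (coalg T X x).peek).peek :=
    ⟨_, coalg_peek_pos T x⟩
  rw [← shape_eq] at mem_range
  exact ⟨s, mem_range⟩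

theorem Phi_eq_of_coalg_eq {X : Type u} {x : T X} {s : T PUnit}
    {v : Fin ((containerOf T).arity s) → X} {g : (Fin ((containerOf T).arity s) → PUnit) → T PUnit}
    (hx : coalg T PUnit x = ⟨(containerOf T).arity s, v, g⟩)
    (hs : g (fun _ => PUnit.unit) = s) : Phi T x = ⟨s, v⟩ := by
  unfold Phi
  -- `Phi` reindexes along a proof about `coalg T PUnit x`, which blocks rewriting with `hx`.
  generalize_proofs dim_eq
  generalize coalg T PUnit x = r at hx dim_eq
  subst hx
  dsimp only at dim_eq ⊢
  generalize g (fun _ => PUnit.unit) = s' at hs dim_eq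
  subst hs
  rfl

theorem Phi_fill {X : Type u} (s : T PUnit) (v : Fin ((containerOf T).arity s) → X) :
    Phi T (fill T s v) = ⟨s, v⟩ := by
  refine Phi_eq_of_coalg_eq T (coalg_fill T PUnit s v) ?_
  have peek_pos := coalg_peek_pos T s
  rwa [coalg_shape] at peek_pos

theorem Phi_bijective (X : Type u) :
    Function.Bijective (Phi T : T X → (containerOf T).Ext X) := by
  refine ⟨fun x y hxy => ?_, fun c => ⟨fill T c.1 c.2, Phi_fill T c.1 c.2⟩⟩
  obtain ⟨s, v, rfl⟩ := exists_fill_eq T x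
  obtain ⟨s', v', rfl⟩ := exists_fill_eq T y
  rw [Phi_fill, Phi_fill] at hxy
  cases hxy
  rfl

variable {F : Type u → Type u} [Applicative F] [LawfulApplicative F] {A B : Type u}

theorem traverse_fill (f : A → F B) (s : T PUnit) (v : Fin ((containerOf T).arity s) → A) :
    traverse f (fill T s v) = fill T s <$> collect f ((containerOf T).arity s) v := by
  rw [traverse_eq_lift_coalg, coalg_fill, FreeApp.lift_apply]

theorem Phi_map_traverse (f : A → F B) (x : T A) :
    Phi T <$> traverse f x = traverse f (Phi T x) := by
  obtain ⟨s, v, rfl⟩ := exists_fill_eq T x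
  simp only [traverse_fill, Functor.map_map, Phi_fill]
  rfl

end Traversal

end TraversableContainer

theorem mainTheorem7 (T : Type u → Type u) [Traversable T] [LawfulTraversable T] :
    (∀ X : Type u, Function.Bijective
      (TraversableContainer.Phi T : T X → (TraversableContainer.containerOf T).Ext X)) ∧
    ∀ (F : Type u → Type u) [Applicative F] [LawfulApplicative F] (A B : Type u)
      (f : A → F B) (x : T A),
      TraversableContainer.Phi T <$> traverse f x = traverse f (TraversableContainer.Phi T x) :=
  ⟨TraversableContainer.Phi_bijective T,
    fun _ _ _ _ _ f x => TraversableContainer.Phi_map_traverse T f x⟩
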